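/- Let $\{\xi(x),\,x\in\mathbb R^d\}$ be a stationary, 0–1-valued random field on a probability space $(\Omega,\mathfrak A,\mathbf P)$ such that $(x,\omega)\mapsto\xi(x,\omega)$ is $\mathfrak B(\mathbb R^d)\otimes\mathfrak A$-measurable, and let $\Xi=\{x\in\mathbb R^d:\xi(x)=1\}$. Let $|\cdot|$ denote Lebesgue measure. For bounded random variables put $$\Gamma(Y_1,\dots,Y_k)=i^{-k}\frac{\partial^k}{\partial s_1\cdots\partial s_k}\log\mathbf E\exp\Big\{i\sum_{j=1}^k s_jY_j\Big\}\Big|_{s_1=\dots=s_k=0},\qquad \Gamma_k(Y)=\Gamma(Y,\dots,Y),$$ and let $c^{(k)}_\Xi(x_1,\dots,x_k)=\Gamma(\xi(x_1),\dots,\xi(x_k))$, $p=\mathbf E\,\xi(o)$, $C(x)=\mathbf E\,\xi(o)\xi(x)$ and $$G_k(\Xi)=\int_{(\mathbb R^d)^{k-1}}|c^{(k)}_\Xi(o,x_2,\dots,x_k)|\,d(x_2,\dots,x_k)\in[0,\infty].$$ (a) For every bounded Borel set $W\subseteq\mathbb R^d$ and every $k\ge 2$, $\;|\Gamma_k(|\Xi\cap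 W|)|\le |W|\,G_k(\Xi)$ (with $0\cdot\infty=0$). Now let $(W_n)_{n\ge1}$ be a convex averaging sequence, that is, a nondecreasing sequence of compact convex sets whose union is $\mathbb R^d$; then $|W_n|>0$ for all large $n$. (b) If $G_k(\Xi)<\infty$ for some $k\ge2$, then for this $k$ $$\lim_{n\to\infty}\frac{\Gamma_k(|\Xi\cap W_n|)}{|W_n|}=\int_{(\mathbb R^d)^{k-1}}c^{(k)}_\Xi(o,x_2,\dots,x_k)\,d(x_2,\dots,x_k),$$ the integral being absolutely convergent. (c) Suppose that for some $H,\Delta>0$ one has $G_k(\Xi)\le k!\,H\,\Delta^{k-2}$ for all $k\ge2$, and let $D_\Delta=\{z\in\mathbb C:|z|<1/\Delta\}$. Then, for each $n$, $z\mapsto\log\mathbf E\exp\{z|\Xi\cap W_n|\}$ has an analytic branch on $D_\Delta$ that vanishes at $z=0$, and with this branch of the logarithm the limit $$L(z)=\lim_{n\to\infty}\frac1{|W_n|}\log\mathbf E\exp\{z|\Xi\cap W_n|\}$$ exists for every $z\in D_\Delta$ and is an analytic function on $D_\Delta$. Moreover, for $z\in D_\Delta$, $$L(z)=zp+\frac{z^2}{2}\int_{\mathbb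 R^d}(C(x)-p^2)\,dx+\sum_{k\ge3}\frac{z^k}{k!}\int_{(\mathbb R^d)^{k-1}}c^{(k)}_\Xi(o,x_2,\dots,x_k)\,d(x_2,\dots,x_k),$$ where all integrals and the series converge absolutely. -/

import Mathlib

open MeasureTheory Filter Topology

noncomputable section

/-- The mixed cumulant `Γ(Y₁, …, Y_k)`: the mixed partial derivative `∂ᵏ/∂s₁⋯∂s_k` at `s = 0` of
`log E exp (i ∑ⱼ sⱼ Yⱼ)`, times `i⁻ᵏ`. The mixed partial derivative is the `k`-th Fréchet derivative
evaluated at the coordinate vectors. The value is kept as a complex number (it is a real one for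
bounded variables); near `s = 0` the expectation is close to `1`, where `Complex.log` is smooth. -/
def mixedCumulant {Ω : Type*} [MeasurableSpace Ω] (P : Measure Ω) {k : ℕ}
    (Y : Fin k → Ω → ℝ) : ℂ :=
  (Complex.I ^ k)⁻¹ *
    iteratedFDeriv ℝ k
      (fun s : Fin k → ℝ =>
        Complex.log (∫ ω, Complex.exp (Complex.I * ∑ j, ((s j : ℂ) * (Y j ω : ℂ))) ∂P))
      0 (fun j => Pi.single j (1 : ℝ))

/-- The `k`-th cumulant `Γ_k(X) = Γ(X, …, X)`. -/
def cumulant {Ω : Type*} [MeasurableSpace Ω] (P : Measure Ω) (k : ℕ) (X : Ω → ℝ) : ℂ :=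
  mixedCumulant P (fun _ : Fin k => X)

/-- A measurable, stationary, 0–1-valued random field on `ℝᵈ`: it is jointly measurable in the point
and the outcome, and its finite-dimensional distributions are invariant under translations. -/
structure IsStationaryBinaryField {Ω : Type*} [MeasurableSpace Ω] (P : Measure Ω) {d : ℕ}
    (ξ : EuclideanSpace ℝ (Fin d) → Ω → ℝ) : Prop where
  measurable : Measurable (fun q : EuclideanSpace ℝ (Fin d) × Ω => ξ q.1 q.2)
  zero_or_one : ∀ x ω, ξ x ω = 0 ∨ ξ x ω = 1
  stationary : ∀ (m : ℕ) (x : Fin m → EuclideanSpace ℝ (Fin d)) (h : EuclideanSpace ℝ (Fin d)),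
    P.map (fun ω (i : Fin m) => ξ (x i + h) ω) = P.map (fun ω (i : Fin m) => ξ (x i) ω)

/-- The support set `Ξ(ω) = {x : ξ(x, ω) = 1}`. -/
def supportSet {Ω : Type*} {d : ℕ} (ξ : EuclideanSpace ℝ (Fin d) → Ω → ℝ) (ω : Ω) :
    Set (EuclideanSpace ℝ (Fin d)) :=
  {x | ξ x ω = 1}

/-- The random variable `|Ξ ∩ W|`. -/
def coveredVolume {Ω : Type*} {d : ℕ} (ξ : EuclideanSpace ℝ (Fin d) → Ω → ℝ)
    (W : Set (EuclideanSpace ℝ (Fin d))) (ω : Ω) : ℝ :=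
  volume.real (supportSet ξ ω ∩ W)

/-- `p^{(k)}(x₁, …, x_k) = E ξ(x₁) ⋯ ξ(x_k)`. -/
def momentFn {Ω : Type*} [MeasurableSpace Ω] (P : Measure Ω) {d : ℕ}
    (ξ : EuclideanSpace ℝ (Fin d) → Ω → ℝ) {k : ℕ} (x : Fin k → EuclideanSpace ℝ (Fin d)) : ℝ :=
  ∫ ω, ∏ j, ξ (x j) ω ∂P

/-- `c^{(k)}(x₁, …, x_k) = Γ(ξ(x₁), …, ξ(x_k))`. -/
def cumulantFn {Ω : Type*} [MeasurableSpace Ω] (P : Measure Ω) {d : ℕ}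
    (ξ : EuclideanSpace ℝ (Fin d) → Ω → ℝ) {k : ℕ} (x : Fin k → EuclideanSpace ℝ (Fin d)) : ℂ :=
  mixedCumulant P (fun j => ξ (x j))

/-- `(x₂, …, x_k) ↦ c^{(k)}(o, x₂, …, x_k)`, for `k ≥ 1`. -/
def pinnedCumulantFn {Ω : Type*} [MeasurableSpace Ω] (P : Measure Ω) {d : ℕ}
    (ξ : EuclideanSpace ℝ (Fin d) → Ω → ℝ) (k : ℕ)
    (y : Fin (k - 1) → EuclideanSpace ℝ (Fin d)) : ℂ :=
  cumulantFn P ξ (Fin.cons 0 y : Fin (k - 1 + 1) → EuclideanSpace ℝ (Fin d))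

/-- `G_k(Ξ) = ∫ |c^{(k)}(o, x₂, …, x_k)| d(x₂, …, x_k)`, possibly infinite. -/
def absCumulantIntegral {Ω : Type*} [MeasurableSpace Ω] (P : Measure Ω) {d : ℕ}
    (ξ : EuclideanSpace ℝ (Fin d) → Ω → ℝ) (k : ℕ) : ENNReal :=
  ∫⁻ y, ‖pinnedCumulantFn P ξ k y‖ₑ

/-- A convex averaging sequence: a nondecreasing sequence of compact convex sets with union `ℝᵈ`. -/
structure IsConvexAveraging {d : ℕ} (W : ℕ → Set (EuclideanSpace ℝ (Fin d))) : Prop where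
  isCompact : ∀ n, IsCompact (W n)
  convex : ∀ n, Convex ℝ (W n)
  monotone : Monotone W
  iUnion_eq : ⋃ n, W n = Set.univ

/-- `ℓ` is the analytic branch on `D` of `z ↦ log E exp (z X)` that vanishes at `z = 0`. (If `D` is
a disk about `0`, there is at most one such function on `D`, and there is one only if
`E exp (z X)` has no zero in `D`.) -/
structure IsLogMGFBranch {Ω : Type*} [MeasurableSpace Ω] (P : Measure Ω) (X : Ω → ℝ)
    (D : Set ℂ) (ℓ : ℂ → ℂ) : Prop where
  analytic : AnalyticOnNhd ℂ ℓ D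
  map_zero : ℓ 0 = 0
  exp_eq : ∀ z ∈ D, Complex.exp (ℓ z) = ∫ ω, Complex.exp (z * (X ω : ℂ)) ∂P

end

/-! Faà di Bruno's formula for `log ∘ φ`, `φ` the characteristic function, writes a mixed cumulant
as a sum over partitions of products of moments (`mixedCumulant_eq_sum`). Each term is linear in
each variable, so Fubini gives `Γ_k(∫ ξ dμ) = ∫ c^(k) dμ^k` (`cumulant_integral_eq`). By
stationarity `c^(k)` depends only on differences, and substituting `x_j = x + y_j` turns `Γ_k(|Ξ ∩
W|)` into the integral of `c^(k)(o, y)` over all `(x, y)` with `x` and every `x + y_j` in `W`.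

Keeping only the constraint `x ∈ W` gives (a). Integrating out `x` leaves the weight `|W ∩ ⋂ (W -
y_j)| ≤ |W|`; divided by `|W_n|` it tends to `1` by convexity
(`IsConvexAveraging.tendsto_innerSet_div`), so dominated convergence gives (b).

For (c), the bound (a) makes the cumulant series of `|Ξ ∩ W_n|` converge on `D_Δ`. It is the Taylor
series of `log E exp(zX)` at `0`, and the identity theorem carries the exponentiated identity to the
whole disk (`isLogMGFBranch_tsum`). After division by `|W_n|` the terms have a geometric bound
independent of `n`, so the limit is taken term by term. -/

theorem integrable_of_measurable_of_norm_le {α E : Type*} [MeasurableSpace α]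
    [NormedAddCommGroup E] {μ : Measure α} [IsFiniteMeasure μ] {f : α → E}
    (hf : AEStronglyMeasurable f μ) (C : ℝ) (h : ∀ x, ‖f x‖ ≤ C) : Integrable f μ :=
  Integrable.of_bound hf C (Eventually.of_forall h)

/-- The bilinear form `(v, w) ↦ -(2π)⁻¹ ∑ j, vⱼ wⱼ`. -/
noncomputable def negDotForm (ι : Type*) [Fintype ι] : (ι → ℝ) →L[ℝ] (ι → ℝ) →L[ℝ] ℝ :=
  (-(2 * Real.pi)⁻¹) • ∑ j, (ContinuousLinearMap.mul ℝ ℝ).bilinearComp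
    (ContinuousLinearMap.proj j) (ContinuousLinearMap.proj j)

theorem negDotForm_apply {ι : Type*} [Fintype ι] (v w : ι → ℝ) :
    negDotForm ι v w = -(2 * Real.pi)⁻¹ * ∑ j, v j * w j := by
  simp [negDotForm]

/-- The Fourier kernel is `exp (-2πi L(v, s))`, so the factor `-(2π)⁻¹` in `negDotForm` cancels both
sign and `2π`. Smoothness and derivatives of the characteristic function then come from Fourier
theory. -/
theorem integral_exp_eq_fourierIntegral {Ω ι : Type*} [MeasurableSpace Ω] [Fintype ι]
    (P : Measure Ω) {Y : ι → Ω → ℝ} (hY : ∀ j, Measurable (Y j)) :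
    (fun s : ι → ℝ => ∫ ω, Complex.exp (Complex.I * ∑ j, ((s j : ℂ) * (Y j ω : ℂ))) ∂P) =
      VectorFourier.fourierIntegral Real.fourierChar (P.map fun ω j => Y j ω)
        (negDotForm ι).toLinearMap₁₂ (fun _ => (1 : ℂ)) := by
  ext s
  have hm : Measurable fun ω j => Y j ω := measurable_pi_lambda _ hY
  rw [VectorFourier.fourierIntegral, integral_map hm.aemeasurable]
  · congr 1 with ω
    simp only [Circle.smul_def, Real.fourierChar_apply, smul_eq_mul, mul_one]
    congr 1
    have : ((negDotForm ι).toLinearMap₁₂ (fun j => Y j ω)) s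
        = -(2 * Real.pi)⁻¹ * ∑ j, Y j ω * s j := negDotForm_apply _ _
    rw [this]
    push_cast
    have : (Real.pi : ℂ) ≠ 0 := by exact_mod_cast Real.pi_ne_zero
    field_simp
    simp only [mul_comm]
  · refine Continuous.aestronglyMeasurable ?_
    simp only [Circle.smul_def, Real.fourierChar_apply, smul_eq_mul, mul_one]
    have : Continuous fun v : ι → ℝ => ((negDotForm ι).toLinearMap₁₂ v) s :=
      ((negDotForm ι).flip s).continuous
    fun_prop

/-! ### Smoothness of the characteristic function and its derivatives at 0 -/

section CharacteristicFunction

variable {Ω ι : Type*} [MeasurableSpace Ω] [Fintype ι] {P : Measure Ω} [IsProbabilityMeasure P]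
  {Y : ι → Ω → ℝ} {C : ℝ}

theorem integrable_norm_pow_map (hY : ∀ j, Measurable (Y j)) (hC : ∀ j ω, |Y j ω| ≤ C) (n : ℕ) :
    Integrable (fun v : ι → ℝ => ‖v‖ ^ n * ‖(1 : ℂ)‖) (P.map fun ω j => Y j ω) := by
  have hm : Measurable fun ω j => Y j ω := measurable_pi_lambda _ hY
  rw [integrable_map_measure (by fun_prop) hm.aemeasurable]
  -- With `ι` empty, `C` may be negative; hence `|C|`.
  refine integrable_of_measurable_of_norm_le
    ((hm.norm.pow_const n).mul_const _).aestronglyMeasurable (|C| ^ n) fun ω => ?_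
  simp only [Function.comp_apply, norm_one, mul_one, norm_pow, norm_norm]
  gcongr
  refine (pi_norm_le_iff_of_nonneg (abs_nonneg _)).2 fun j => ?_
  exact (hC j ω).trans (le_abs_self _)

theorem contDiff_integral_exp (hY : ∀ j, Measurable (Y j)) (hC : ∀ j ω, |Y j ω| ≤ C) (N : ℕ∞) :
    ContDiff ℝ N (fun s : ι → ℝ =>
      ∫ ω, Complex.exp (Complex.I * ∑ j, ((s j : ℂ) * (Y j ω : ℂ))) ∂P) := by
  rw [integral_exp_eq_fourierIntegral P hY]
  exact VectorFourier.contDiff_fourierIntegral _ fun n _ => integrable_norm_pow_map hY hC n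

theorem iteratedFDeriv_integral_exp_zero (hY : ∀ j, Measurable (Y j)) (hC : ∀ j ω, |Y j ω| ≤ C)
    (n : ℕ) (m : Fin n → ι → ℝ) :
    iteratedFDeriv ℝ n (fun s : ι → ℝ =>
      ∫ ω, Complex.exp (Complex.I * ∑ j, ((s j : ℂ) * (Y j ω : ℂ))) ∂P) 0 m =
      Complex.I ^ n * ((∫ ω, ∏ i, ∑ j, m i j * Y j ω ∂P : ℝ) : ℂ) := by
  have hm : Measurable fun ω j => Y j ω := measurable_pi_lambda _ hY
  have : IsProbabilityMeasure (P.map fun ω j => Y j ω) :=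
    Measure.isProbabilityMeasure_map hm.aemeasurable
  rw [integral_exp_eq_fourierIntegral P hY,
    VectorFourier.iteratedFDeriv_fourierIntegral (N := ⊤) _
      (fun k _ => integrable_norm_pow_map hY hC k) aestronglyMeasurable_const le_top,
    VectorFourier.fourierIntegral_continuousMultilinearMap_apply (by fun_prop)]
  · simp only [VectorFourier.fourierIntegral, map_zero, neg_zero, AddChar.map_zero_eq_one,
      one_smul, VectorFourier.fourierPowSMulRight_apply]
    rw [integral_map hm.aemeasurable]
    · rw [← integral_complex_ofReal, ← integral_const_mul]
      congr 1 with ω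
      simp only [negDotForm_apply, Finset.prod_mul_distrib, Finset.prod_const, Finset.card_univ,
        Fintype.card_fin]
      have hpi : (Real.pi : ℂ) ≠ 0 := by exact_mod_cast Real.pi_ne_zero
      simp only [Complex.real_smul, smul_eq_mul, mul_one]
      push_cast
      rw [← mul_assoc, ← mul_pow]
      congr 1
      · congr 1
        field_simp
      · simp only [mul_comm]
    · refine Continuous.aestronglyMeasurable ?_
      simp only [negDotForm_apply]
      fun_prop
  · exact VectorFourier.integrable_fourierPowSMulRight _ (integrable_norm_pow_map hY hC n)
      aestronglyMeasurable_const

end CharacteristicFunction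

/-! ### The moment–cumulant formula -/

theorem contDiffAt_log_one {n : WithTop ℕ∞} : ContDiffAt ℂ n Complex.log 1 :=
  Complex.contDiffAt_log (by simp)

/-- The characteristic function has real arguments, so the chain rule is applied over `ℝ`. As `log`
is holomorphic, its real derivatives are restrictions of complex multilinear maps, each determined
by one number. -/
theorem iteratedFDeriv_real_log_one (n : ℕ) (v : Fin n → ℂ) :
    iteratedFDeriv ℝ n Complex.log 1 v = (∏ i, v i) * iteratedDeriv n Complex.log 1 := by
  have h : ContDiffAt ℂ n Complex.log 1 := contDiffAt_log_one
  rw [← h.restrictScalars_iteratedFDeriv (𝕜 := ℝ)]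
  simp only [Function.comp_apply, ContinuousMultilinearMap.coe_restrictScalars]
  rw [iteratedFDeriv_apply_eq_iteratedDeriv_mul_prod, smul_eq_mul]

theorem prod_I_pow_partSize {k : ℕ} (c : OrderedFinpartition k) :
    ∏ m, Complex.I ^ c.partSize m = Complex.I ^ k := by
  have := c.prod_sigma_eq_prod (fun _ => Complex.I)
  simpa using this

section Formula

variable {Ω : Type*} [MeasurableSpace Ω] {P : Measure Ω} [IsProbabilityMeasure P]

/-- Faà di Bruno: a part of the partition receives the coordinate directions of its indices, hence
yields the joint moment over that part. The powers of `I` multiply to `I ^ k` and cancel the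
prefactor. -/
theorem mixedCumulant_eq_sum {k : ℕ} {Y : Fin k → Ω → ℝ} {C : ℝ} (hY : ∀ j, Measurable (Y j))
    (hC : ∀ j ω, |Y j ω| ≤ C) :
    mixedCumulant P Y = ∑ c : OrderedFinpartition k, iteratedDeriv c.length Complex.log 1 *
      ∏ m, ((∫ ω, ∏ r, Y (c.emb m r) ω ∂P : ℝ) : ℂ) := by
  set φ := fun s : Fin k → ℝ =>
    ∫ ω, Complex.exp (Complex.I * ∑ j, ((s j : ℂ) * (Y j ω : ℂ))) ∂P with hφ
  have h0 : φ 0 = 1 := by simp [hφ]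
  have hcomp := iteratedFDeriv_comp (𝕜 := ℝ) (n := k) (g := Complex.log) (f := φ) (x := 0)
    (by rw [h0]; exact contDiffAt_log_one.restrict_scalars ℝ)
    (contDiff_integral_exp hY hC k).contDiffAt le_rfl
  have hd : mixedCumulant P Y = (Complex.I ^ k)⁻¹ *
      iteratedFDeriv ℝ k (Complex.log ∘ φ) 0 (fun j => Pi.single j (1 : ℝ)) := rfl
  rw [hd, hcomp, h0]
  simp only [FormalMultilinearSeries.taylorComp, sum_apply,
    FormalMultilinearSeries.compAlongOrderedFinpartition_apply, Finset.mul_sum]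
  refine Finset.sum_congr rfl fun c _ => ?_
  have : ∀ m, c.applyOrderedFinpartition (fun m => ftaylorSeries ℝ φ 0 (c.partSize m))
      (fun j => Pi.single j (1 : ℝ)) m =
      Complex.I ^ c.partSize m * ((∫ ω, ∏ r, Y (c.emb m r) ω ∂P : ℝ) : ℂ) := by
    intro m
    rw [OrderedFinpartition.applyOrderedFinpartition_apply]
    refine (iteratedFDeriv_integral_exp_zero hY hC _ _).trans ?_
    simp [Pi.single_apply]
  rw [funext this]
  change _ * iteratedFDeriv ℝ c.length Complex.log 1 _ = _
  rw [iteratedFDeriv_real_log_one, Finset.prod_mul_distrib, prod_I_pow_partSize]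
  have hI : Complex.I ^ k ≠ 0 := pow_ne_zero _ Complex.I_ne_zero
  field_simp

theorem integrableExpSet_eq_univ {X : Ω → ℝ} {C : ℝ} (hX : Measurable X) (hC : ∀ ω, |X ω| ≤ C) :
    ProbabilityTheory.integrableExpSet X P = Set.univ := by
  refine Set.eq_univ_of_forall fun t => ?_
  refine integrable_of_measurable_of_norm_le (by fun_prop) (Real.exp (|t| * C)) fun ω => ?_
  rw [Real.norm_eq_abs, Real.abs_exp, Real.exp_le_exp]
  refine (le_abs_self _).trans ?_
  rw [abs_mul]
  exact mul_le_mul_of_nonneg_left (hC ω) (abs_nonneg _)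

theorem analyticOnNhd_complexMGF_univ {X : Ω → ℝ} {C : ℝ} (hX : Measurable X)
    (hC : ∀ ω, |X ω| ≤ C) : AnalyticOnNhd ℂ (ProbabilityTheory.complexMGF X P) Set.univ := by
  have := ProbabilityTheory.analyticOnNhd_complexMGF (X := X) (μ := P)
  simpa [integrableExpSet_eq_univ hX hC] using this

theorem complexMGF_zero' (X : Ω → ℝ) : ProbabilityTheory.complexMGF X P 0 = 1 := by
  simp [ProbabilityTheory.complexMGF]

theorem analyticAt_log_complexMGF {X : Ω → ℝ} {C : ℝ} (hX : Measurable X)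
    (hC : ∀ ω, |X ω| ≤ C) :
    AnalyticAt ℂ (Complex.log ∘ ProbabilityTheory.complexMGF X P) 0 := by
  refine AnalyticAt.comp ?_ (analyticOnNhd_complexMGF_univ hX hC 0 trivial)
  rw [complexMGF_zero']
  exact analyticAt_clog (by simp)

/-- Both sides expand by Faà di Bruno into the same sum over partitions of moments of `X`, so the
real variables `s_j` and the complex variable `z` need no direct comparison. -/
theorem cumulant_eq_iteratedDeriv {X : Ω → ℝ} {C : ℝ} (hX : Measurable X)
    (hC : ∀ ω, |X ω| ≤ C) (k : ℕ) :
    cumulant P k X = iteratedDeriv k (Complex.log ∘ ProbabilityTheory.complexMGF X P) 0 := by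
  have h0 := complexMGF_zero' (P := P) X
  rw [cumulant, mixedCumulant_eq_sum (fun _ => hX) (fun _ => hC), iteratedDeriv_eq_iteratedFDeriv,
    iteratedFDeriv_comp (n := k) (by rw [h0]; exact contDiffAt_log_one)
      (analyticOnNhd_complexMGF_univ hX hC 0 trivial).contDiffAt le_rfl, h0]
  simp only [FormalMultilinearSeries.taylorComp, sum_apply,
    FormalMultilinearSeries.compAlongOrderedFinpartition_apply]
  refine Finset.sum_congr rfl fun c _ => ?_
  change _ = iteratedFDeriv ℂ c.length Complex.log 1 _
  rw [iteratedFDeriv_apply_eq_iteratedDeriv_mul_prod, smul_eq_mul, mul_comm]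
  congr 1
  refine Finset.prod_congr rfl fun m _ => ?_
  rw [OrderedFinpartition.applyOrderedFinpartition_apply]
  change _ = iteratedFDeriv ℂ (c.partSize m) _ 0 (fun _ => 1)
  rw [← iteratedDeriv_eq_iteratedFDeriv, ProbabilityTheory.iteratedDeriv_complexMGF
    (by simp [integrableExpSet_eq_univ hX hC])]
  rw [← integral_complex_ofReal]
  simp

theorem iteratedDeriv_one_log_one : iteratedDeriv 1 Complex.log 1 = 1 := by
  rw [iteratedDeriv_one, (Complex.hasDerivAt_log (by simp)).deriv, inv_one]

theorem iteratedDeriv_two_log_one : iteratedDeriv 2 Complex.log 1 = -1 := by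
  rw [iteratedDeriv_succ, iteratedDeriv_one]
  have : deriv Complex.log =ᶠ[𝓝 1] fun z => z⁻¹ := by
    filter_upwards [Complex.isOpen_slitPlane.mem_nhds (Complex.one_mem_slitPlane)] with z hz
    exact (Complex.hasDerivAt_log hz).deriv
  rw [this.deriv_eq]
  simp

theorem mixedCumulant_one {Y : Fin 1 → Ω → ℝ} {C : ℝ} (hY : ∀ j, Measurable (Y j))
    (hC : ∀ j ω, |Y j ω| ≤ C) : mixedCumulant P Y = ((∫ ω, Y 0 ω ∂P : ℝ) : ℂ) := by
  rw [mixedCumulant_eq_sum hY hC, Fintype.sum_unique]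
  change iteratedDeriv 1 Complex.log 1 * ∏ m : Fin 1, ((∫ ω, ∏ r : Fin 1, Y m ω ∂P : ℝ) : ℂ) = _
  rw [iteratedDeriv_one_log_one, Fin.prod_univ_one]
  simp only [Fin.prod_univ_one, one_mul]

/-- A new point joins the one-point partition either as a separate part or inside its only part. -/
theorem sum_orderedFinpartition_two {M : Type*} [AddCommMonoid M]
    (f : OrderedFinpartition 2 → M) :
    ∑ c, f c = f (OrderedFinpartition.atomic 1).extendLeft +
      f ((OrderedFinpartition.atomic 1).extendMiddle (0 : Fin 1)) := by
  have hsome : ∀ g : Fin 1 → M, ∑ i, g i = g 0 := fun g => by simp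
  rw [← (OrderedFinpartition.extendEquiv 1).sum_comp, Fintype.sum_sigma, Fintype.sum_unique,
    Fintype.sum_option]
  exact congrArg _ (hsome fun i => f ((OrderedFinpartition.atomic 1).extendMiddle i))

theorem mixedCumulant_two {Y : Fin 2 → Ω → ℝ} {C : ℝ} (hY : ∀ j, Measurable (Y j))
    (hC : ∀ j ω, |Y j ω| ≤ C) : mixedCumulant P Y =
      ((∫ ω, Y 0 ω * Y 1 ω ∂P - (∫ ω, Y 0 ω ∂P) * ∫ ω, Y 1 ω ∂P : ℝ) : ℂ) := by
  rw [mixedCumulant_eq_sum hY hC, sum_orderedFinpartition_two]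
  change iteratedDeriv 2 Complex.log 1 * ∏ m : Fin 2, ((∫ ω, ∏ r,
      Y (((OrderedFinpartition.atomic 1).extendLeft).emb m r) ω ∂P : ℝ) : ℂ) +
    iteratedDeriv 1 Complex.log 1 * ∏ m : Fin 1, ((∫ ω, ∏ r,
      Y (((OrderedFinpartition.atomic 1).extendMiddle (0 : Fin 1)).emb m r) ω ∂P : ℝ) : ℂ) = _
  rw [Fin.prod_univ_two, Fin.prod_univ_one]
  change iteratedDeriv 2 Complex.log 1 * (((∫ ω, ∏ r : Fin 1, Y 0 ω ∂P : ℝ) : ℂ) *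
      ((∫ ω, ∏ r : Fin 1, Y 1 ω ∂P : ℝ) : ℂ)) +
    iteratedDeriv 1 Complex.log 1 * ((∫ ω, ∏ r : Fin 2,
      Y (((OrderedFinpartition.atomic 1).extendMiddle (0 : Fin 1)).emb (0 : Fin 1) r) ω ∂P : ℝ) : ℂ) = _
  have h0 : ((OrderedFinpartition.atomic 1).extendMiddle (0 : Fin 1)).emb (0 : Fin 1) (0 : Fin 2) = 0 := rfl
  have h1 : ((OrderedFinpartition.atomic 1).extendMiddle (0 : Fin 1)).emb (0 : Fin 1) (1 : Fin 2) = 1 := rfl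
  simp only [Fin.prod_univ_two, Fin.prod_univ_one, h0, h1, iteratedDeriv_one_log_one,
    iteratedDeriv_two_log_one]
  push_cast
  ring

end Formula

/-! ### Cumulants of an integrated field -/

theorem OrderedFinpartition.index_emb {n : ℕ} (c : OrderedFinpartition n) (m : Fin c.length)
    (r : Fin (c.partSize m)) : c.index (c.emb m r) = m :=
  congrArg Sigma.fst (c.equivSigma.left_inv ⟨m, r⟩)

theorem OrderedFinpartition.prod_index_eq_prod {n : ℕ} (c : OrderedFinpartition n) {M : Type*}
    [CommMonoid M] (g : Fin n → Fin c.length → M) :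
    ∏ j, g j (c.index j) = ∏ m, ∏ r, g (c.emb m r) m := by
  rw [← c.prod_sigma_eq_prod]
  simp only [c.index_emb]

theorem norm_prod_le_one {ι : Type*} [Fintype ι] {a : ι → ℝ} (h : ∀ i, |a i| ≤ 1) :
    ‖∏ i, a i‖ ≤ 1 := by
  rw [norm_prod]
  exact Finset.prod_le_one (fun _ _ => norm_nonneg _) fun i _ => h i

theorem norm_integral_prod_le_one {ι : Type*} [Fintype ι] {Ω E : Type*} [MeasurableSpace Ω] {P : Measure Ω}
    [IsProbabilityMeasure P] {f : E → Ω → ℝ} (hb : ∀ x ω, |f x ω| ≤ 1)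
    (x : ι → E) : ‖∫ ω, ∏ r, f (x r) ω ∂P‖ ≤ 1 := by
  refine (norm_integral_le_of_norm_le_const (C := 1) (Eventually.of_forall fun ω =>
    norm_prod_le_one fun i => hb _ _)).trans ?_
  simp

section Fubini

variable {Ω E : Type*} [MeasurableSpace Ω] [MeasurableSpace E] {P : Measure Ω}
  [IsProbabilityMeasure P] {f : E → Ω → ℝ}

theorem Measurable.comp_uncurry {α : Type*} [MeasurableSpace α]
    (hf : Measurable fun q : E × Ω => f q.1 q.2) {u : α → E} {v : α → Ω} (hu : Measurable u)
    (hv : Measurable v) : Measurable fun a => f (u a) (v a) :=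
  hf.comp (hu.prodMk hv)

theorem measurable_integral_prod {ι κ : Type*} [Fintype ι]
    (hf : Measurable fun q : E × Ω => f q.1 q.2) (e : ι → κ) :
    Measurable fun x : κ → E => ∫ ω, ∏ r, f (x (e r)) ω ∂P := by
  have : Measurable fun q : (κ → E) × Ω => ∏ r, f (q.1 (e r)) q.2 :=
    Finset.measurable_fun_prod _ fun r _ =>
      hf.comp_uncurry ((measurable_pi_apply (e r)).comp measurable_fst) measurable_snd
  exact (this.stronglyMeasurable.integral_prod_right (ν := P)).measurable

/-- A product over the parts of a partition of moments of `∫ f(x) dμ(x)`, as a multiple integral. -/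
theorem prod_moment_integral_eq {μ : Measure E} [IsFiniteMeasure μ]
    (hf : Measurable fun q : E × Ω => f q.1 q.2) (hb : ∀ x ω, |f x ω| ≤ 1)
    {k : ℕ} (c : OrderedFinpartition k) :
    ∏ m, ∫ ω, ∏ _r : Fin (c.partSize m), ∫ x, f x ω ∂μ ∂P =
      ∫ x, ∏ m, ∫ ω, ∏ r, f (x (c.emb m r)) ω ∂P ∂(Measure.pi fun _ : Fin k => μ) := by
  have hmeas : Measurable fun q : (Fin c.length → Ω) × (Fin k → E) =>
      ∏ j, f (q.2 j) (q.1 (c.index j)) :=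
    Finset.measurable_fun_prod _ fun j _ =>
      hf.comp_uncurry ((measurable_pi_apply j).comp measurable_snd)
        ((measurable_pi_apply (c.index j)).comp measurable_fst)
  -- One independent copy of `Ω` per part and one of `E` per index make the product a single double
  -- integral; after the swap the `ω`-integral factors again over the parts.
  calc ∏ m, ∫ ω, ∏ _r : Fin (c.partSize m), ∫ x, f x ω ∂μ ∂P
    _ = ∫ ω : Fin c.length → Ω, ∏ m, ∏ _r : Fin (c.partSize m), ∫ x, f x (ω m) ∂μ
          ∂(Measure.pi fun _ => P) :=
        (integral_fintype_prod_eq_prod (𝕜 := ℝ) (μ := fun _ : Fin c.length => P)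
          (fun m ω => ∏ _r : Fin (c.partSize m), ∫ x, f x ω ∂μ)).symm
    _ = ∫ ω : Fin c.length → Ω, ∫ x, ∏ j, f (x j) (ω (c.index j)) ∂(Measure.pi fun _ => μ)
          ∂(Measure.pi fun _ => P) := by
        congr 1 with ω
        rw [integral_fintype_prod_eq_prod (𝕜 := ℝ) (μ := fun _ : Fin k => μ)
          (fun j x => f x (ω (c.index j)))]
        exact (c.prod_index_eq_prod fun _ m => ∫ x, f x (ω m) ∂μ).symm
    _ = ∫ x, ∫ ω : Fin c.length → Ω, ∏ j, f (x j) (ω (c.index j)) ∂(Measure.pi fun _ => P)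
          ∂(Measure.pi fun _ => μ) :=
        integral_integral_swap (integrable_of_measurable_of_norm_le hmeas.aestronglyMeasurable 1
          fun q => norm_prod_le_one fun j => hb _ _)
    _ = _ := by
        congr 1 with x
        rw [← integral_fintype_prod_eq_prod (𝕜 := ℝ) (μ := fun _ : Fin c.length => P)
          (fun m ω => ∏ r, f (x (c.emb m r)) ω)]
        congr 1 with ω
        exact c.prod_index_eq_prod fun j m => f (x j) (ω m)

theorem mixedCumulant_field_eq (hf : Measurable fun q : E × Ω => f q.1 q.2)
    (hb : ∀ x ω, |f x ω| ≤ 1) {k : ℕ} (x : Fin k → E) :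
    mixedCumulant P (fun j => f (x j)) =
      ∑ c : OrderedFinpartition k, iteratedDeriv c.length Complex.log 1 *
        ((∏ m, ∫ ω, ∏ r, f (x (c.emb m r)) ω ∂P : ℝ) : ℂ) := by
  rw [mixedCumulant_eq_sum (C := 1) (Y := fun j => f (x j))
    (fun j => hf.comp_uncurry measurable_const measurable_id) fun j ω => hb _ _]
  push_cast
  rfl

theorem measurable_mixedCumulant_field (hf : Measurable fun q : E × Ω => f q.1 q.2)
    (hb : ∀ x ω, |f x ω| ≤ 1) (k : ℕ) :
    Measurable fun x : Fin k → E => mixedCumulant P (fun j => f (x j)) := by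
  simp only [mixedCumulant_field_eq hf hb]
  refine Finset.measurable_fun_sum _ fun c _ => Measurable.const_mul ?_ _
  exact Complex.measurable_ofReal.comp
    (Finset.measurable_fun_prod _ fun m _ => measurable_integral_prod hf _)

theorem cumulant_integral_eq {μ : Measure E} [IsFiniteMeasure μ]
    (hf : Measurable fun q : E × Ω => f q.1 q.2) (hb : ∀ x ω, |f x ω| ≤ 1) (k : ℕ) :
    cumulant P k (fun ω => ∫ x, f x ω ∂μ) =
      ∫ x, mixedCumulant P (fun j => f (x j)) ∂(Measure.pi fun _ : Fin k => μ) := by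
  have hX : Measurable fun ω => ∫ x, f x ω ∂μ :=
    (hf.stronglyMeasurable.integral_prod_left (μ := μ)).measurable
  have hXb : ∀ ω, |∫ x, f x ω ∂μ| ≤ 1 * μ.real Set.univ := fun ω =>
    norm_integral_le_of_norm_le_const (μ := μ) (f := fun x => f x ω) (Eventually.of_forall fun x => hb x ω)
  simp only [mixedCumulant_field_eq hf hb]
  rw [cumulant, mixedCumulant_eq_sum (fun _ => hX) fun _ => hXb, integral_finsetSum]
  · refine Finset.sum_congr rfl fun c _ => ?_
    rw [integral_const_mul, integral_complex_ofReal, ← prod_moment_integral_eq hf hb]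
    push_cast
    rfl
  · intro c _
    refine Integrable.const_mul (Integrable.ofReal
      (f := fun x : Fin k → E => ∏ m, ∫ ω, ∏ r, f (x (c.emb m r)) ω ∂P) ?_) _
    exact integrable_of_measurable_of_norm_le
      (Finset.measurable_fun_prod _ fun m _ => measurable_integral_prod hf _).aestronglyMeasurable 1
      fun x => norm_prod_le_one fun m => norm_integral_prod_le_one hb _

end Fubini

/-- Cumulants depend only on the joint law, the object that stationarity speaks of. -/
theorem mixedCumulant_map {Ω : Type*} [MeasurableSpace Ω] {P : Measure Ω} {k : ℕ}
    {Y : Fin k → Ω → ℝ} (hY : ∀ j, Measurable (Y j)) :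
    mixedCumulant P Y = mixedCumulant (P.map fun ω j => Y j ω) (fun j y => y j) := by
  have hm : Measurable fun ω j => Y j ω := measurable_pi_lambda _ hY
  have key : ∀ s : Fin k → ℝ,
      ∫ ω, Complex.exp (Complex.I * ∑ j, ((s j : ℂ) * (Y j ω : ℂ))) ∂P =
        ∫ y, Complex.exp (Complex.I * ∑ j, ((s j : ℂ) * ((y j : ℝ) : ℂ)))
          ∂(P.map fun ω j => Y j ω) := fun s => by
    rw [integral_map hm.aemeasurable (Continuous.aestronglyMeasurable (by fun_prop))]
  simp only [mixedCumulant, key]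

/-! ### Stationarity and the covered volume -/

section Field

variable {Ω : Type*} [MeasurableSpace Ω] {P : Measure Ω} {d : ℕ}
  {ξ : EuclideanSpace ℝ (Fin d) → Ω → ℝ}

theorem IsStationaryBinaryField.abs_le_one (hξ : IsStationaryBinaryField P ξ) (x ω) :
    |ξ x ω| ≤ 1 := by
  rcases hξ.zero_or_one x ω with h | h <;> simp [h]

theorem IsStationaryBinaryField.measurable_apply (hξ : IsStationaryBinaryField P ξ) (x) :
    Measurable (ξ x) :=
  hξ.measurable.comp measurable_prodMk_left

theorem IsStationaryBinaryField.cumulantFn_add (hξ : IsStationaryBinaryField P ξ) {k : ℕ}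
    (x : Fin k → EuclideanSpace ℝ (Fin d)) (h : EuclideanSpace ℝ (Fin d)) :
    cumulantFn P ξ (fun j => x j + h) = cumulantFn P ξ x := by
  unfold cumulantFn
  rw [mixedCumulant_map fun j => hξ.measurable_apply _,
    mixedCumulant_map fun j => hξ.measurable_apply _, hξ.stationary]

theorem IsStationaryBinaryField.measurableSet_supportSet (hξ : IsStationaryBinaryField P ξ)
    (ω : Ω) : MeasurableSet (supportSet ξ ω) :=
  (hξ.measurable.comp measurable_prodMk_right) (measurableSet_singleton 1)

theorem IsStationaryBinaryField.coveredVolume_eq (hξ : IsStationaryBinaryField P ξ)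
    (W : Set (EuclideanSpace ℝ (Fin d))) :
    coveredVolume ξ W = fun ω => ∫ x, ξ x ω ∂(volume.restrict W) := by
  ext ω
  have : (fun x => ξ x ω) = (supportSet ξ ω).indicator 1 := by
    ext x
    by_cases h : x ∈ supportSet ξ ω
    · rw [Set.indicator_of_mem h]; exact h
    · rw [Set.indicator_of_notMem h]; exact (hξ.zero_or_one x ω).resolve_right h
  rw [this, integral_indicator_one (hξ.measurableSet_supportSet ω), coveredVolume, measureReal_def,
    measureReal_def, Measure.restrict_apply (hξ.measurableSet_supportSet ω)]

theorem IsStationaryBinaryField.measurable_coveredVolume (hξ : IsStationaryBinaryField P ξ)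
    (W : Set (EuclideanSpace ℝ (Fin d))) : Measurable (coveredVolume ξ W) := by
  rw [hξ.coveredVolume_eq]
  exact (hξ.measurable.stronglyMeasurable.integral_prod_left (μ := volume.restrict W)).measurable

omit [MeasurableSpace Ω] in
theorem abs_coveredVolume_le {W : Set (EuclideanSpace ℝ (Fin d))} (hW : volume W ≠ ⊤) (ω : Ω) :
    |coveredVolume ξ W ω| ≤ volume.real W := by
  rw [coveredVolume, abs_of_nonneg measureReal_nonneg]
  exact measureReal_mono Set.inter_subset_right hW

/-- Pairs `(x, y)` such that `x` and all the points `x + yⱼ` lie in `W`. -/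
def translatesWithin {E : Type*} [Add E] (W : Set E) (k : ℕ) : Set (E × (Fin k → E)) :=
  {q | q.1 ∈ W ∧ ∀ j, q.1 + q.2 j ∈ W}

theorem measurableSet_translatesWithin {W : Set (EuclideanSpace ℝ (Fin d))}
    (hW : MeasurableSet W) (k : ℕ) : MeasurableSet (translatesWithin W k) := by
  have : translatesWithin W k = Prod.fst ⁻¹' W ∩ ⋂ j : Fin k, (fun q : _ × (Fin k → _) => q.1 + q.2 j) ⁻¹' W := by
    ext q; simp [translatesWithin]
  rw [this]
  refine (measurable_fst hW).inter (MeasurableSet.iInter fun j => ?_)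
  have : Measurable fun q : EuclideanSpace ℝ (Fin d) × (Fin k → EuclideanSpace ℝ (Fin d)) =>
      q.1 + q.2 j := measurable_fst.add ((measurable_pi_apply j).comp measurable_snd)
  exact this hW

/-- For each fixed first coordinate the map is a translation of the remaining ones. -/
theorem measurePreserving_shear (k : ℕ) : MeasurePreserving
    (fun q : EuclideanSpace ℝ (Fin d) × (Fin k → EuclideanSpace ℝ (Fin d)) =>
      (q.1, fun j => q.1 + q.2 j)) := by
  refine (MeasurePreserving.id volume).skew_product
    (g := fun (x : EuclideanSpace ℝ (Fin d)) (y : Fin k → EuclideanSpace ℝ (Fin d)) j => x + y j)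
    (measurable_pi_lambda _ fun j => measurable_fst.add
      ((measurable_pi_apply j).comp measurable_snd)) (Eventually.of_forall fun x => ?_)
  exact (measurePreserving_add_left volume fun _ : Fin k => x).map_eq

variable [IsProbabilityMeasure P]

theorem IsStationaryBinaryField.measurable_pinnedCumulantFn (hξ : IsStationaryBinaryField P ξ)
    (k : ℕ) : Measurable (pinnedCumulantFn P ξ k) := by
  refine (measurable_mixedCumulant_field hξ.measurable hξ.abs_le_one (k - 1 + 1)).comp ?_
  refine measurable_pi_lambda _ fun j => ?_
  refine Fin.cases ?_ (fun i => ?_) j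
  · exact measurable_const
  · exact measurable_pi_apply i

/-- The first point `x` is split off and the others are written as `x + y_j`; stationarity then
moves `x` to the origin. Finiteness of `G_k` plays no role here. -/
theorem IsStationaryBinaryField.cumulant_coveredVolume (hξ : IsStationaryBinaryField P ξ)
    {W : Set (EuclideanSpace ℝ (Fin d))} (hW : MeasurableSet W) (hfin : volume W ≠ ⊤) (k : ℕ) :
    cumulant P (k + 1) (coveredVolume ξ W) =
      ∫ q : EuclideanSpace ℝ (Fin d) × (Fin k → EuclideanSpace ℝ (Fin d)),
        (translatesWithin W k).indicator (fun q => pinnedCumulantFn P ξ (k + 1) q.2) q := by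
  have : Fact (volume W < ⊤) := ⟨hfin.lt_top⟩
  have hmeas : Measurable ((Set.univ.pi fun _ : Fin (k + 1) => W).indicator
      fun x => mixedCumulant P fun j => ξ (x j)) :=
    (measurable_mixedCumulant_field hξ.measurable hξ.abs_le_one _).indicator
      (MeasurableSet.univ_pi fun _ => hW)
  have hmp := (volume_preserving_piFinSuccAbove (fun _ => EuclideanSpace ℝ (Fin d))
    (0 : Fin (k + 1))).symm
  have hshear := measurePreserving_shear (d := d) k
  rw [hξ.coveredVolume_eq, cumulant_integral_eq hξ.measurable hξ.abs_le_one,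
    ← Measure.restrict_pi_pi, ← integral_indicator (MeasurableSet.univ_pi fun _ => hW),
    ← volume_pi, ← hmp.integral_comp']
  have hsub := integral_map (μ := volume) hshear.measurable.aemeasurable
    (hmeas.comp hmp.measurable).aestronglyMeasurable
  rw [hshear.map_eq] at hsub
  refine hsub.trans ?_
  congr 1 with q
  have hcons : (MeasurableEquiv.piFinSuccAbove (fun _ => EuclideanSpace ℝ (Fin d))
      (0 : Fin (k + 1))).symm (q.1, fun j => q.1 + q.2 j) =
      fun j => (Fin.cons 0 q.2 : Fin (k + 1) → EuclideanSpace ℝ (Fin d)) j + q.1 := by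
    ext1 j
    refine Fin.cases ?_ (fun i => ?_) j
    · simp [MeasurableEquiv.piFinSuccAbove]
    · simp [MeasurableEquiv.piFinSuccAbove, add_comm]
  rw [Function.comp_apply, hcons]
  by_cases hq : q ∈ translatesWithin W k
  · rw [Set.indicator_of_mem hq, Set.indicator_of_mem]
    · exact hξ.cumulantFn_add _ q.1
    · intro j _
      refine Fin.cases ?_ (fun i => ?_) j
      · simpa using hq.1
      · simpa [add_comm] using hq.2 i
  · rw [Set.indicator_of_notMem hq, Set.indicator_of_notMem]
    refine fun h => hq ⟨?_, fun j => ?_⟩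
    · simpa using h 0 trivial
    · simpa [add_comm] using h j.succ trivial

end Field

/-! ### The cumulant bound and the weighted integral -/

section CumulantBound

variable {Ω : Type*} [MeasurableSpace Ω] {P : Measure Ω} [IsProbabilityMeasure P] {d : ℕ}
  {ξ : EuclideanSpace ℝ (Fin d) → Ω → ℝ}

/-- Dropping all constraints except `x ∈ W` leaves a product integrand. Working in `[0, ∞]` covers
infinite `G_k`. -/
theorem IsStationaryBinaryField.lintegral_indicator_le (hξ : IsStationaryBinaryField P ξ)
    {W : Set (EuclideanSpace ℝ (Fin d))} (hW : MeasurableSet W) (k : ℕ) :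
    ∫⁻ q : EuclideanSpace ℝ (Fin d) × (Fin k → EuclideanSpace ℝ (Fin d)),
      ‖(translatesWithin W k).indicator (fun q => pinnedCumulantFn P ξ (k + 1) q.2) q‖ₑ ≤
      volume W * absCumulantIntegral P ξ (k + 1) := by
  have hc : Measurable fun y : Fin k → EuclideanSpace ℝ (Fin d) =>
      ‖pinnedCumulantFn P ξ (k + 1) y‖ₑ := (hξ.measurable_pinnedCumulantFn (k + 1)).enorm
  have hprod := lintegral_prod_mul (μ := (volume : Measure (EuclideanSpace ℝ (Fin d))))
    (ν := volume) (f := W.indicator 1) (measurable_one.indicator hW).aemeasurable hc.aemeasurable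
  rw [lintegral_indicator_one hW] at hprod
  refine le_trans (lintegral_mono fun q => ?_) hprod.le
  by_cases hq : q ∈ translatesWithin W k
  · simp [Set.indicator_of_mem hq, Set.indicator_of_mem hq.1]
  · simp [Set.indicator_of_notMem hq]

theorem IsStationaryBinaryField.enorm_cumulant_le (hξ : IsStationaryBinaryField P ξ)
    {W : Set (EuclideanSpace ℝ (Fin d))} (hW : MeasurableSet W) (hfin : volume W ≠ ⊤) (k : ℕ) :
    ‖cumulant P (k + 1) (coveredVolume ξ W)‖ₑ ≤
      volume W * absCumulantIntegral P ξ (k + 1) := by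
  rw [hξ.cumulant_coveredVolume hW hfin]
  exact (enorm_integral_le_lintegral_enorm _).trans (hξ.lintegral_indicator_le hW k)

theorem IsStationaryBinaryField.integrable_pinnedCumulantFn (hξ : IsStationaryBinaryField P ξ)
    {k : ℕ} (h : absCumulantIntegral P ξ k < ⊤) : Integrable (pinnedCumulantFn P ξ k) :=
  ⟨(hξ.measurable_pinnedCumulantFn k).aestronglyMeasurable, h⟩

/-- Points `x` of `W` such that all the points `x + yⱼ` lie in `W`. -/
def innerSet {E : Type*} [Add E] (W : Set E) {k : ℕ} (y : Fin k → E) : Set E :=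
  {x | x ∈ W ∧ ∀ j, x + y j ∈ W}

theorem IsStationaryBinaryField.cumulant_coveredVolume_eq_integral
    (hξ : IsStationaryBinaryField P ξ) {W : Set (EuclideanSpace ℝ (Fin d))} (hW : MeasurableSet W)
    (hfin : volume W ≠ ⊤) {k : ℕ} (h : absCumulantIntegral P ξ (k + 1) < ⊤) :
    cumulant P (k + 1) (coveredVolume ξ W) = ∫ y : Fin k → EuclideanSpace ℝ (Fin d),
      (volume.real (innerSet W y) : ℂ) * pinnedCumulantFn P ξ (k + 1) y := by
  have hT := measurableSet_translatesWithin hW k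
  have hc : Measurable fun y : Fin k → EuclideanSpace ℝ (Fin d) =>
      pinnedCumulantFn P ξ (k + 1) y := hξ.measurable_pinnedCumulantFn (k + 1)
  have hint : Integrable (fun q : EuclideanSpace ℝ (Fin d) × (Fin k → EuclideanSpace ℝ (Fin d)) =>
      (translatesWithin W k).indicator (fun q => pinnedCumulantFn P ξ (k + 1) q.2) q)
      (volume.prod volume) :=
    ⟨((hc.comp measurable_snd).indicator hT).aestronglyMeasurable,
      (hξ.lintegral_indicator_le hW k).trans_lt (ENNReal.mul_lt_top hfin.lt_top h)⟩
  rw [hξ.cumulant_coveredVolume hW hfin, Measure.volume_eq_prod, integral_prod_symm _ hint]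
  congr 1 with y
  have hS : MeasurableSet (innerSet W y) := measurable_prodMk_right (y := y) hT
  have : (fun x => (translatesWithin W k).indicator
      (fun q => pinnedCumulantFn P ξ (k + 1) q.2) (x, y)) =
      (innerSet W y).indicator fun _ => pinnedCumulantFn P ξ (k + 1) y := rfl
  rw [this, integral_indicator_const _ hS, Complex.real_smul]

end CumulantBound

/-! ### Geometry of convex averaging sequences -/

section Convex

variable {d : ℕ}

/-- `(1 - ε) w + y_j` is the convex combination of `w` and `ε⁻¹ y_j` with weights `1 - ε` and `ε`.
-/
theorem Convex.smul_subset_innerSet {E : Type*} [AddCommGroup E] [Module ℝ E] {W : Set E}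
    (hW : Convex ℝ W) (h0 : (0 : E) ∈ W) {k : ℕ} {y : Fin k → E} {ε : ℝ} (hε : 0 < ε)
    (hε1 : ε ≤ 1) (hy : ∀ j, ε⁻¹ • y j ∈ W) : (fun x => (1 - ε) • x) '' W ⊆ innerSet W y := by
  rintro _ ⟨w, hw, rfl⟩
  refine ⟨?_, fun j => ?_⟩
  · simpa using hW hw h0 (sub_nonneg.2 hε1) hε.le (by ring)
  · have := hW hw (hy j) (sub_nonneg.2 hε1) hε.le (by ring)
    rwa [smul_inv_smul₀ hε.ne'] at this

variable {W : ℕ → Set (EuclideanSpace ℝ (Fin d))}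

theorem IsConvexAveraging.eventually_mem (hW : IsConvexAveraging W)
    (x : EuclideanSpace ℝ (Fin d)) : ∀ᶠ n in atTop, x ∈ W n := by
  have : x ∈ ⋃ n, W n := hW.iUnion_eq ▸ Set.mem_univ x
  obtain ⟨n, hn⟩ := Set.mem_iUnion.1 this
  exact eventually_atTop.2 ⟨n, fun m hm => hW.monotone hm hn⟩

theorem IsConvexAveraging.volume_ne_top (hW : IsConvexAveraging W) (n : ℕ) : volume (W n) ≠ ⊤ :=
  (hW.isCompact n).measure_lt_top.ne

theorem IsConvexAveraging.eventually_volume_pos (hW : IsConvexAveraging W) :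
    ∀ᶠ n in atTop, 0 < volume.real (W n) := by
  have h := tendsto_measure_iUnion_atTop (μ := (volume : Measure (EuclideanSpace ℝ (Fin d))))
    hW.monotone
  rw [hW.iUnion_eq] at h
  have hpos : 0 < volume (Set.univ : Set (EuclideanSpace ℝ (Fin d))) :=
    isOpen_univ.measure_pos volume Set.univ_nonempty
  filter_upwards [h.eventually_const_lt hpos] with n hn
  exact ENNReal.toReal_pos hn.ne' (hW.volume_ne_top n)

theorem volume_real_innerSet_le {W : Set (EuclideanSpace ℝ (Fin d))} (hfin : volume W ≠ ⊤) {k : ℕ}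
    (y : Fin k → EuclideanSpace ℝ (Fin d)) : volume.real (innerSet W y) ≤ volume.real W :=
  measureReal_mono (fun _ hx => hx.1) hfin

/-- For fixed `ε`, the points `0` and `ε⁻¹ y_j` eventually lie in `W n`, so the ratio is at least
`(1 - ε) ^ d`; it never exceeds `1`. -/
theorem IsConvexAveraging.tendsto_innerSet_div (hW : IsConvexAveraging W) {k : ℕ}
    (y : Fin k → EuclideanSpace ℝ (Fin d)) :
    Tendsto (fun n => volume.real (innerSet (W n) y) / volume.real (W n)) atTop (𝓝 1) := by
  have hlow : ∀ ε : ℝ, 0 < ε → ε ≤ 1 → ∀ᶠ n in atTop,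
      (1 - ε) ^ d ≤ volume.real (innerSet (W n) y) / volume.real (W n) := by
    intro ε hε hε1
    filter_upwards [hW.eventually_volume_pos, hW.eventually_mem 0,
      eventually_all.2 fun j => hW.eventually_mem (ε⁻¹ • y j)] with n hn h0 hy
    rw [le_div_iff₀ hn]
    have hsub := (hW.convex n).smul_subset_innerSet h0 hε hε1 hy
    have hle := measureReal_mono (μ := volume) hsub
      (measure_ne_top_of_subset (fun _ hx => hx.1) (hW.volume_ne_top n))
    have hsmul := Measure.addHaar_smul (volume : Measure (EuclideanSpace ℝ (Fin d))) (1 - ε) (W n)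
    rw [finrank_euclideanSpace_fin, abs_of_nonneg (pow_nonneg (sub_nonneg.2 hε1) _)] at hsmul
    have hreal : volume.real ((fun x => (1 - ε) • x) '' W n) = (1 - ε) ^ d * volume.real (W n) := by
      rw [measureReal_def, Set.image_smul, hsmul, ENNReal.toReal_mul,
        ENNReal.toReal_ofReal (pow_nonneg (sub_nonneg.2 hε1) _), measureReal_def]
    rw [← hreal]
    exact hle
  refine tendsto_order.2 ⟨fun a ha => ?_, fun a ha => ?_⟩
  · have hlim : Tendsto (fun ε : ℝ => (1 - ε) ^ d) (𝓝[>] 0) (𝓝 1) := by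
      have : Continuous fun ε : ℝ => (1 - ε) ^ d := by fun_prop
      simpa using (this.tendsto 0).mono_left nhdsWithin_le_nhds
    obtain ⟨ε, h1, h2, h3⟩ := ((hlim.eventually_const_lt ha).and
      ((eventually_mem_nhdsWithin).and
        (eventually_nhdsWithin_of_eventually_nhds (eventually_le_nhds zero_lt_one)))).exists
    filter_upwards [hlow ε h2 h3] with n hn
    exact h1.trans_le hn
  · exact Eventually.of_forall fun n =>
      (div_le_one_of_le₀ (volume_real_innerSet_le (hW.volume_ne_top n) y)
        measureReal_nonneg).trans_lt ha

end Convex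

/-! ### Convergence of the normalized cumulants -/

section Limit

variable {Ω : Type*} [MeasurableSpace Ω] {P : Measure Ω} [IsProbabilityMeasure P] {d : ℕ}
  {ξ : EuclideanSpace ℝ (Fin d) → Ω → ℝ}

theorem IsStationaryBinaryField.tendsto_cumulant_div (hξ : IsStationaryBinaryField P ξ)
    {W : ℕ → Set (EuclideanSpace ℝ (Fin d))} (hW : IsConvexAveraging W) {k : ℕ}
    (h : absCumulantIntegral P ξ (k + 1) < ⊤) :
    Tendsto (fun n => cumulant P (k + 1) (coveredVolume ξ (W n)) /
      ((volume.real (W n) : ℝ) : ℂ)) atTop (𝓝 (∫ y, pinnedCumulantFn P ξ (k + 1) y)) := by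
  have hmeas : ∀ n, MeasurableSet (W n) := fun n => (hW.isCompact n).measurableSet
  have heq : ∀ n, cumulant P (k + 1) (coveredVolume ξ (W n)) / ((volume.real (W n) : ℝ) : ℂ) =
      ∫ y : Fin k → EuclideanSpace ℝ (Fin d),
        ((volume.real (innerSet (W n) y) / volume.real (W n) : ℝ) : ℂ) *
          pinnedCumulantFn P ξ (k + 1) y := by
    intro n
    rw [hξ.cumulant_coveredVolume_eq_integral (hmeas n) (hW.volume_ne_top n) h,
      ← integral_div]
    congr 1 with y
    push_cast
    ring
  simp only [heq]
  have hint : Integrable fun y : Fin k → EuclideanSpace ℝ (Fin d) =>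
      pinnedCumulantFn P ξ (k + 1) y := hξ.integrable_pinnedCumulantFn h
  refine tendsto_integral_of_dominated_convergence
    (fun y => ‖pinnedCumulantFn P ξ (k + 1) y‖) (fun n => ?_) hint.norm
    (fun n => Eventually.of_forall fun y => ?_) (Eventually.of_forall fun y => ?_)
  · have hT := measurableSet_translatesWithin (hmeas n) k
    have hvol : Measurable fun y : Fin k → EuclideanSpace ℝ (Fin d) =>
        volume (innerSet (W n) y) := measurable_measure_prodMk_right hT
    exact (Complex.measurable_ofReal.comp (hvol.ennreal_toReal.div_const _)).aestronglyMeasurable.mul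
      hint.aestronglyMeasurable
  -- The bound holds for every `n`: if `|W n| = 0`, the quotient is `0`.
  · rw [norm_mul, Complex.norm_real, Real.norm_of_nonneg (by positivity)]
    exact mul_le_of_le_one_left (norm_nonneg _) (div_le_one_of_le₀
      (volume_real_innerSet_le (hW.volume_ne_top n) y) measureReal_nonneg)
  · have := ((Complex.continuous_ofReal.tendsto 1).comp (hW.tendsto_innerSet_div y)).mul_const
      (pinnedCumulantFn P ξ (k + 1) y)
    simpa using this

end Limit

/-! ### Power series with geometrically bounded coefficients -/

section PowerSeries

variable {a : ℕ → ℂ} {C Δ : ℝ}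

theorem hasFPowerSeriesOnBall_tsum_of_norm_le (hΔ : 0 < Δ) (ha : ∀ k, ‖a k‖ ≤ C * Δ ^ k) :
    HasFPowerSeriesOnBall (fun z => ∑' k, a k * z ^ k) (FormalMultilinearSeries.ofScalars ℂ a) 0
      (ENNReal.ofReal (1 / Δ)) := by
  have hr : ENNReal.ofReal (1 / Δ) ≤ (FormalMultilinearSeries.ofScalars ℂ a).radius := by
    refine FormalMultilinearSeries.le_radius_of_bound _ C fun n => ?_
    rw [FormalMultilinearSeries.ofScalars_norm, Real.coe_toNNReal _ (by positivity)]
    calc ‖a n‖ * (1 / Δ) ^ n ≤ C * Δ ^ n * (1 / Δ) ^ n := by gcongr; exact ha n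
      _ = C := by rw [mul_assoc, ← mul_pow, mul_one_div_cancel hΔ.ne', one_pow, mul_one]
  have hpos : 0 < ENNReal.ofReal (1 / Δ) := ENNReal.ofReal_pos.2 (by positivity)
  have := ((FormalMultilinearSeries.ofScalars ℂ a).hasFPowerSeriesOnBall (hpos.trans_le hr)).mono
    hpos hr
  have hsum : (FormalMultilinearSeries.ofScalars ℂ a).sum = fun z => ∑' k, a k * z ^ k :=
    FormalMultilinearSeries.ofScalarsSum_eq_tsum a
  rwa [hsum] at this

theorem analyticOnNhd_tsum_of_norm_le (hΔ : 0 < Δ) (ha : ∀ k, ‖a k‖ ≤ C * Δ ^ k) :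
    AnalyticOnNhd ℂ (fun z => ∑' k, a k * z ^ k) (Metric.ball 0 (1 / Δ)) := by
  rw [← Metric.eball_ofReal]
  exact (hasFPowerSeriesOnBall_tsum_of_norm_le hΔ ha).analyticOnNhd

theorem summable_mul_norm_pow (C : ℝ) (hΔ : 0 < Δ) {z : ℂ}
    (hz : z ∈ Metric.ball (0 : ℂ) (1 / Δ)) :
    Summable fun k => C * Δ ^ k * ‖z‖ ^ k := by
  have : ∀ k, C * Δ ^ k * ‖z‖ ^ k = C * (Δ * ‖z‖) ^ k := fun k => by rw [mul_pow, mul_assoc]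
  simp only [this]
  refine (summable_geometric_of_lt_one (by positivity) ?_).mul_left C
  rw [mem_ball_zero_iff, lt_div_iff₀ hΔ] at hz
  rwa [mul_comm]

theorem norm_mul_pow_le (ha : ∀ k, ‖a k‖ ≤ C * Δ ^ k) (z : ℂ) (k : ℕ) :
    ‖a k * z ^ k‖ ≤ C * Δ ^ k * ‖z‖ ^ k := by
  rw [norm_mul, norm_pow]
  exact mul_le_mul_of_nonneg_right (ha k) (by positivity)

end PowerSeries

/-! ### The analytic logarithm of the moment generating function -/

section Branch

variable {Ω : Type*} [MeasurableSpace Ω] {P : Measure Ω} [IsProbabilityMeasure P]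

theorem cumulant_zero (X : Ω → ℝ) : cumulant P 0 X = 0 := by
  simp [cumulant, mixedCumulant]

/-- Geometric bounds for the cumulants give the logarithm of the moment generating function on a
disk. -/
theorem isLogMGFBranch_tsum {X : Ω → ℝ} {B C Δ : ℝ} (hX : Measurable X) (hB : ∀ ω, |X ω| ≤ B)
    (hΔ : 0 < Δ) (ha : ∀ k, ‖cumulant P k X / (k.factorial : ℂ)‖ ≤ C * Δ ^ k) :
    IsLogMGFBranch P X (Metric.ball 0 (1 / Δ))
      (fun z => ∑' k, cumulant P k X / (k.factorial : ℂ) * z ^ k) := by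
  have han := analyticOnNhd_tsum_of_norm_le hΔ ha
  refine ⟨han, ?_, ?_⟩
  · rw [tsum_eq_single 0 fun k hk => by simp [hk]]
    simp [cumulant_zero]
  · have hlog := (analyticAt_log_complexMGF (P := P) hX hB).hasFPowerSeriesAt
    simp only [← cumulant_eq_iteratedDeriv hX hB] at hlog
    have hnear : (fun z => ∑' k, cumulant P k X / (k.factorial : ℂ) * z ^ k) =ᶠ[𝓝 0]
        Complex.log ∘ ProbabilityTheory.complexMGF X P := by
      filter_upwards
        [(hasFPowerSeriesOnBall_tsum_of_norm_le hΔ ha).hasFPowerSeriesAt.eventually_hasSum,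
          hlog.eventually_hasSum] with z h1 h2
      simpa using h1.unique h2
    have hM := analyticOnNhd_complexMGF_univ (P := P) hX hB
    have hne : ∀ᶠ z in 𝓝 (0 : ℂ), ProbabilityTheory.complexMGF X P z ≠ 0 :=
      (hM 0 trivial).continuousAt.eventually_ne (by simp [complexMGF_zero'])
    have hexp : (fun z => Complex.exp (∑' k, cumulant P k X / (k.factorial : ℂ) * z ^ k)) =ᶠ[𝓝 0]
        ProbabilityTheory.complexMGF X P := by
      filter_upwards [hnear, hne] with z h1 h2
      rw [h1, Function.comp_apply, Complex.exp_log h2]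
    -- The identity theorem is applied after exponentiating: the principal logarithm may be
    -- discontinuous along the moment generating function away from `0`.
    exact AnalyticOnNhd.eqOn_of_preconnected_of_eventuallyEq han.cexp
      (hM.mono (Set.subset_univ _)) (convex_ball _ _).isPreconnected
      (Metric.mem_ball_self (by positivity)) hexp

end Branch

/-! ### Low-order coefficients and the thermodynamic limit -/

section Pinned

variable {Ω : Type*} [MeasurableSpace Ω] {P : Measure Ω} [IsProbabilityMeasure P] {d : ℕ}
  {ξ : EuclideanSpace ℝ (Fin d) → Ω → ℝ}

theorem IsStationaryBinaryField.pinnedCumulantFn_one (hξ : IsStationaryBinaryField P ξ)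
    (y : Fin 0 → EuclideanSpace ℝ (Fin d)) :
    pinnedCumulantFn P ξ 1 y = (momentFn P ξ ![0] : ℂ) := by
  refine (mixedCumulant_one (fun j => hξ.measurable_apply _)
    fun j ω => hξ.abs_le_one _ ω).trans ?_
  simp [momentFn]

theorem IsStationaryBinaryField.integral_pinnedCumulantFn_one
    (hξ : IsStationaryBinaryField P ξ) :
    ∫ y, pinnedCumulantFn P ξ 1 y = (momentFn P ξ ![0] : ℂ) := by
  have : ∀ y, pinnedCumulantFn P ξ 1 y = (momentFn P ξ ![0] : ℂ) := hξ.pinnedCumulantFn_one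
  simp only [this, integral_const, volume_pi]
  simp [measureReal_def]

/-- The integral is over a one-point space of mass `1`. This supplies the case `k = 1`, about which
the hypothesis of (c) is silent. -/
theorem IsStationaryBinaryField.absCumulantIntegral_one_lt_top
    (hξ : IsStationaryBinaryField P ξ) : absCumulantIntegral P ξ 1 < ⊤ := by
  have : ∀ y, pinnedCumulantFn P ξ 1 y = (momentFn P ξ ![0] : ℂ) := hξ.pinnedCumulantFn_one
  simp only [absCumulantIntegral, this, lintegral_const, volume_pi]
  simp

theorem IsStationaryBinaryField.pinnedCumulantFn_two (hξ : IsStationaryBinaryField P ξ)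
    (y : Fin 1 → EuclideanSpace ℝ (Fin d)) :
    pinnedCumulantFn P ξ 2 y =
      ((momentFn P ξ ![0, y 0] - momentFn P ξ ![0] ^ 2 : ℝ) : ℂ) := by
  refine (mixedCumulant_two (fun j => hξ.measurable_apply _)
    fun j ω => hξ.abs_le_one _ ω).trans ?_
  have hmom : ∀ x, ∫ ω, ξ x ω ∂P = momentFn P ξ ![x] := fun x => by simp [momentFn]
  -- The mean is the first cumulant, so its translation invariance is a case of `cumulantFn_add`.
  have hp : momentFn P ξ ![y 0] = momentFn P ξ ![0] := by
    have h1 := mixedCumulant_one (P := P) (Y := fun j => ξ ((![0] : Fin 1 → _) j))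
      (fun j => hξ.measurable_apply _) fun j ω => hξ.abs_le_one _ ω
    have h2 := mixedCumulant_one (P := P) (Y := fun j => ξ ((![0] : Fin 1 → _) j + y 0))
      (fun j => hξ.measurable_apply _) fun j ω => hξ.abs_le_one _ ω
    have h3 := hξ.cumulantFn_add (![0] : Fin 1 → _) (y 0)
    simp only [cumulantFn] at h3
    rw [h1, h2] at h3
    simpa [momentFn] using h3
  congr 1
  change ∫ ω, ξ 0 ω * ξ (y 0) ω ∂P - (∫ ω, ξ 0 ω ∂P) * ∫ ω, ξ (y 0) ω ∂P = _
  rw [hmom, hmom, hp, sq]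
  simp [momentFn]

theorem IsStationaryBinaryField.integrable_covariance (hξ : IsStationaryBinaryField P ξ)
    (h : absCumulantIntegral P ξ 2 < ⊤) :
    Integrable (fun x => momentFn P ξ ![0, x] - momentFn P ξ ![0] ^ 2) := by
  have hint : Integrable fun y : Fin 1 → EuclideanSpace ℝ (Fin d) =>
      ((momentFn P ξ ![0, y 0] - momentFn P ξ ![0] ^ 2 : ℝ) : ℂ) := by
    simp only [← hξ.pinnedCumulantFn_two]
    exact hξ.integrable_pinnedCumulantFn h
  have hmp := volume_preserving_funUnique (Fin 1) (EuclideanSpace ℝ (Fin d))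
  exact (hmp.integrable_comp_emb (MeasurableEquiv.measurableEmbedding _)).1 hint.re

theorem IsStationaryBinaryField.integral_pinnedCumulantFn_two
    (hξ : IsStationaryBinaryField P ξ) :
    ∫ y, pinnedCumulantFn P ξ 2 y =
      ((∫ x, (momentFn P ξ ![0, x] - momentFn P ξ ![0] ^ 2) : ℝ) : ℂ) := by
  have : ∀ y, pinnedCumulantFn P ξ 2 y =
      ((momentFn P ξ ![0, y 0] - momentFn P ξ ![0] ^ 2 : ℝ) : ℂ) := hξ.pinnedCumulantFn_two
  have hmp := volume_preserving_funUnique (Fin 1) (EuclideanSpace ℝ (Fin d))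
  simp only [this]
  rw [integral_complex_ofReal]
  congr 1
  exact hmp.integral_comp' fun x => momentFn P ξ ![0, x] - momentFn P ξ ![0] ^ 2

/-- The Taylor coefficients of the thermodynamic limit. -/
noncomputable def limitCoeff {Ω : Type*} [MeasurableSpace Ω] (P : Measure Ω) {d : ℕ}
    (ξ : EuclideanSpace ℝ (Fin d) → Ω → ℝ) : ℕ → ℂ
  | 0 => 0
  | k + 1 => (∫ y, pinnedCumulantFn P ξ (k + 1) y) / ((k + 1).factorial : ℂ)

variable {C Δ : ℝ}

omit [IsProbabilityMeasure P] in
theorem norm_limitCoeff_le (hC : 0 ≤ C) (hΔ : 0 < Δ) (hG : ∀ k, absCumulantIntegral P ξ (k + 1) ≤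
      ENNReal.ofReal (C * Δ ^ (k + 1) * ((k + 1).factorial : ℝ))) (k : ℕ) :
    ‖limitCoeff P ξ k‖ ≤ C * Δ ^ k := by
  cases k with
  | zero => simpa [limitCoeff] using hC
  | succ k =>
    rw [limitCoeff, norm_div, Complex.norm_natCast, div_le_iff₀ (by positivity)]
    have := (enorm_integral_le_lintegral_enorm (pinnedCumulantFn P ξ (k + 1))).trans (hG k)
    rwa [← ofReal_norm, ENNReal.ofReal_le_ofReal_iff (by positivity)] at this

theorem IsStationaryBinaryField.norm_cumulant_div_factorial_le
    (hξ : IsStationaryBinaryField P ξ) (hC : 0 ≤ C) (hΔ : 0 < Δ)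
    (hG : ∀ k, absCumulantIntegral P ξ (k + 1) ≤
      ENNReal.ofReal (C * Δ ^ (k + 1) * ((k + 1).factorial : ℝ)))
    {W : Set (EuclideanSpace ℝ (Fin d))} (hW : MeasurableSet W) (hfin : volume W ≠ ⊤) (k : ℕ) :
    ‖cumulant P k (coveredVolume ξ W) / (k.factorial : ℂ)‖ ≤ volume.real W * C * Δ ^ k := by
  cases k with
  | zero => simpa [cumulant_zero] using mul_nonneg measureReal_nonneg hC
  | succ k =>
    rw [norm_div, Complex.norm_natCast, div_le_iff₀ (by positivity)]
    have := (hξ.enorm_cumulant_le hW hfin k).trans (mul_le_mul_right (hG k) _)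
    rw [← ofReal_measureReal hfin, ← ENNReal.ofReal_mul measureReal_nonneg, ← ofReal_norm,
      ENNReal.ofReal_le_ofReal_iff (by positivity)] at this
    linarith

theorem exists_geometric_bound {G : ℕ → ENNReal} {H : ℝ} (hH : 0 < H) (hΔ : 0 < Δ)
    (h1 : G 1 < ⊤)
    (hG : ∀ k : ℕ, 2 ≤ k → G k ≤ ENNReal.ofReal ((k.factorial : ℝ) * H * Δ ^ (k - 2))) :
    ∃ C : ℝ, 0 ≤ C ∧
      ∀ k, G (k + 1) ≤ ENNReal.ofReal (C * Δ ^ (k + 1) * ((k + 1).factorial : ℝ)) := by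
  -- The first summand absorbs the shift in `Δ ^ (k - 2)`; the second covers `G 1`.
  refine ⟨H / Δ ^ 2 + (G 1).toReal / Δ, by positivity, fun k => ?_⟩
  cases k with
  | zero =>
    refine (ENNReal.ofReal_toReal h1.ne).symm.le.trans (ENNReal.ofReal_le_ofReal ?_)
    have : (H / Δ ^ 2 + (G 1).toReal / Δ) * Δ ^ (0 + 1) * ((0 + 1).factorial : ℝ) =
        H / Δ + (G 1).toReal := by
      simp; field_simp
    rw [this]
    exact le_add_of_nonneg_left (by positivity)
  | succ k =>
    refine (hG (k + 1 + 1) (by omega)).trans (ENNReal.ofReal_le_ofReal ?_)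
    calc ((k + 1 + 1).factorial : ℝ) * H * Δ ^ k
      _ = H / Δ ^ 2 * Δ ^ (k + 1 + 1) * ((k + 1 + 1).factorial : ℝ) := by
          field_simp
          ring
      _ ≤ _ := by
          gcongr
          exact le_add_of_nonneg_right (by positivity)

/-- Tannery's theorem: the volume in the cumulant bound cancels, leaving the summable majorant `C
(Δ|z|)^k` for all `n`. -/
theorem IsStationaryBinaryField.tendsto_inv_volume_mul_tsum
    (hξ : IsStationaryBinaryField P ξ) (hC : 0 ≤ C) (hΔ : 0 < Δ)
    (hG : ∀ k, absCumulantIntegral P ξ (k + 1) ≤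
      ENNReal.ofReal (C * Δ ^ (k + 1) * ((k + 1).factorial : ℝ)))
    {W : ℕ → Set (EuclideanSpace ℝ (Fin d))} (hW : IsConvexAveraging W) {z : ℂ}
    (hz : z ∈ Metric.ball (0 : ℂ) (1 / Δ)) :
    Tendsto (fun n => (((volume.real (W n) : ℝ) : ℂ))⁻¹ *
      ∑' k, cumulant P k (coveredVolume ξ (W n)) / (k.factorial : ℂ) * z ^ k) atTop
      (𝓝 (∑' k, limitCoeff P ξ k * z ^ k)) := by
  simp only [← tsum_mul_left]
  refine tendsto_tsum_of_dominated_convergence (summable_mul_norm_pow C hΔ hz) (fun k => ?_)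
    (Eventually.of_forall fun n k => ?_)
  · cases k with
    | zero => simp [cumulant_zero, limitCoeff]
    | succ k =>
      have := (hξ.tendsto_cumulant_div hW
        ((hG k).trans_lt ENNReal.ofReal_lt_top)).mul_const (z ^ (k + 1) / ((k + 1).factorial : ℂ))
      refine (this.congr fun n => ?_).trans_eq ?_
      · ring
      · rw [limitCoeff]; ring_nf
  · have hle := norm_mul_pow_le (hξ.norm_cumulant_div_factorial_le hC hΔ hG
      (hW.isCompact n).measurableSet (hW.volume_ne_top n)) z k
    rw [norm_mul, norm_inv, Complex.norm_real, Real.norm_of_nonneg measureReal_nonneg]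
    rcases (measureReal_nonneg (μ := volume) (s := W n)).eq_or_lt with h0 | h0
    · rw [← h0, inv_zero, zero_mul]
      positivity
    · rw [inv_mul_le_iff₀ h0]
      linarith

end Pinned

theorem lemma1 {Ω : Type*} [MeasurableSpace Ω] (P : Measure Ω) [IsProbabilityMeasure P] {d : ℕ}
    (ξ : EuclideanSpace ℝ (Fin d) → Ω → ℝ) (hξ : IsStationaryBinaryField P ξ) :
    -- the bound for the cumulants of the covered volume
    (∀ W : Set (EuclideanSpace ℝ (Fin d)), MeasurableSet W → Bornology.IsBounded W →
      ∀ k : ℕ, 2 ≤ k →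
        ‖cumulant P k (coveredVolume ξ W)‖ₑ ≤ volume W * absCumulantIntegral P ξ k) ∧
    (∀ W : ℕ → Set (EuclideanSpace ℝ (Fin d)), IsConvexAveraging W →
      -- the limit of the normalized cumulants
      (∀ k : ℕ, 2 ≤ k → absCumulantIntegral P ξ k < ⊤ →
        Integrable (pinnedCumulantFn P ξ k) ∧
        Tendsto
          (fun n => cumulant P k (coveredVolume ξ (W n)) / ((volume.real (W n) : ℝ) : ℂ))
          atTop (𝓝 (∫ y, pinnedCumulantFn P ξ k y))) ∧
      -- the thermodynamic limit, its analyticity and its power series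
      (∀ H Δ : ℝ, 0 < H → 0 < Δ →
        (∀ k : ℕ, 2 ≤ k →
          absCumulantIntegral P ξ k ≤ ENNReal.ofReal ((k.factorial : ℝ) * H * Δ ^ (k - 2))) →
        ∃ ℓ : ℕ → ℂ → ℂ,
          (∀ n, IsLogMGFBranch P (coveredVolume ξ (W n)) (Metric.ball 0 (1 / Δ)) (ℓ n)) ∧
          ∃ L : ℂ → ℂ,
            AnalyticOnNhd ℂ L (Metric.ball 0 (1 / Δ)) ∧
            (∀ z ∈ Metric.ball (0 : ℂ) (1 / Δ),
              Tendsto (fun n => (((volume.real (W n) : ℝ) : ℂ))⁻¹ * ℓ n z) atTop (𝓝 (L z))) ∧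
            Integrable (fun x => momentFn P ξ ![0, x] - momentFn P ξ ![0] ^ 2) ∧
            (∀ k : ℕ, 3 ≤ k → Integrable (pinnedCumulantFn P ξ k)) ∧
            (∀ z ∈ Metric.ball (0 : ℂ) (1 / Δ),
              HasSum
                (fun j : ℕ => z ^ (j + 3) / ((j + 3).factorial : ℂ) *
                  ∫ y, pinnedCumulantFn P ξ (j + 3) y)
                (L z - (z * (momentFn P ξ ![0] : ℂ) +
                  z ^ 2 / 2 *
                    ((∫ x, (momentFn P ξ ![0, x] - momentFn P ξ ![0] ^ 2) : ℝ) : ℂ)))))) := by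
  refine ⟨fun W hW hb k hk => ?_, fun W hW => ⟨fun k hk hG => ?_, fun H Δ hH hΔ hG => ?_⟩⟩
  · obtain ⟨k, rfl⟩ : ∃ m, k = m + 1 := ⟨k - 1, by omega⟩
    exact hξ.enorm_cumulant_le hW hb.measure_lt_top.ne k
  · refine ⟨hξ.integrable_pinnedCumulantFn hG, ?_⟩
    obtain ⟨k, rfl⟩ : ∃ m, k = m + 1 := ⟨k - 1, by omega⟩
    exact hξ.tendsto_cumulant_div hW hG
  · have hfin : ∀ k, 2 ≤ k → absCumulantIntegral P ξ k < ⊤ := fun k hk =>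
      (hG k hk).trans_lt ENNReal.ofReal_lt_top
    obtain ⟨C, hC, hGC⟩ := exists_geometric_bound hH hΔ hξ.absCumulantIntegral_one_lt_top hG
    have hcoeff := norm_limitCoeff_le hC hΔ hGC
    refine ⟨fun n z => ∑' k, cumulant P k (coveredVolume ξ (W n)) / (k.factorial : ℂ) * z ^ k,
      fun n => isLogMGFBranch_tsum (hξ.measurable_coveredVolume _)
        (abs_coveredVolume_le (hW.volume_ne_top n)) hΔ (hξ.norm_cumulant_div_factorial_le hC hΔ hGC
          (hW.isCompact n).measurableSet (hW.volume_ne_top n)),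
      fun z => ∑' k, limitCoeff P ξ k * z ^ k, analyticOnNhd_tsum_of_norm_le hΔ hcoeff,
      fun z hz => hξ.tendsto_inv_volume_mul_tsum hC hΔ hGC hW hz,
      hξ.integrable_covariance (hfin 2 le_rfl),
      fun k hk => hξ.integrable_pinnedCumulantFn (hfin k (by omega)), fun z hz => ?_⟩
    have hsum : Summable fun k => limitCoeff P ξ k * z ^ k :=
      (summable_mul_norm_pow C hΔ hz).of_norm_bounded fun k => norm_mul_pow_le hcoeff z k
    -- The terms `k = 0, 1, 2` are split off: they are `0`, the mean term and the covariance term.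
    have h3 := (hasSum_nat_add_iff' 3).2 hsum.hasSum
    have hc1 : limitCoeff P ξ 1 = (momentFn P ξ ![0] : ℂ) := by
      rw [limitCoeff, hξ.integral_pinnedCumulantFn_one]; simp
    have hc2 : limitCoeff P ξ 2 =
        ((∫ x, (momentFn P ξ ![0, x] - momentFn P ξ ![0] ^ 2) : ℝ) : ℂ) / 2 := by
      rw [limitCoeff, hξ.integral_pinnedCumulantFn_two]; simp
    have hc0 : limitCoeff P ξ 0 = 0 := rfl
    rw [Finset.sum_range_succ, Finset.sum_range_succ, Finset.sum_range_one, hc0, hc1, hc2] at h3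
    convert! h3 using 1
    · ext j
      rw [limitCoeff]
      ring_nf
    · ring
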